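/- Let $n\ge 1$, let $C\in\mathbb R^{n\times n}$, and let $f:\mathbb R\times\mathbb R^n\to\mathbb R^n$ be continuous with $f(t,0)=0$ for all $t\in\mathbb R$. Let $\alpha$ and $\beta$ be the minimum and the maximum of the real parts of the (complex) eigenvalues of $C$, and let $m_\alpha$ and $m_\beta$ be the maximal degrees of the elementary divisors of $C$ belonging to eigenvalues with real part $\alpha$ and $\beta$, respectively. Assume that there is a nonnegative function $\eta$ on $[0,\infty)$ such that (C3) $\|f(t,x_1)-f(t,x_2)\|\le \eta(t)\|x_1-x_2\|$ for all $t\ge 0$ and $x_1,x_2\in\mathbb R^n$; (C4) $\displaystyle\int_0^\infty t^{m_\beta+m_\alpha-2}e^{(\beta-\alpha)t}\eta(t)\,dt<\infty$; (C5) $\displaystyle\lim_{t\to\infty}\int_t^\infty (s-t)^{m_\alpha-1}s^{m_\beta-1}e^{\alpha(t-s)}e^{\beta s}\eta(s)\,ds=0$. Let $t_0\ge 0$; if $t_0=0$, assume also that $\eta$ is integrable on $[0,1]$. A set of functions is called a $k$-parameter family if it is the image of a nonempty open subset of $\mathbb R^k$ under a continuous injective map; sets of functions carry the topology of locally uniform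 convergence. A continuous function on $[t_0,\infty)$ is called asymptotically almost periodic if it is the restriction of $g+\varphi$, where $g:\mathbb R\to\mathbb R^n$ is (Bohr) almost periodic and $\varphi:\mathbb R\to\mathbb R^n$ is continuous with $\varphi(t)\to0$ as $t\to\infty$. Let $k\le n$ and suppose that $x'=Cx$ has a $k$-parameter family $\gamma_1$ of almost periodic solutions on $\mathbb R$. Then $y'=Cy+f(t,y)$ has a $k$-parameter family $\gamma_2$ of asymptotically almost periodic solutions on $[t_0,\infty)$, and there is a homeomorphism $h:\gamma_1\to\gamma_2$ such that $x(t)-h(x)(t)\to 0$ as $t\to\infty$ for every $x\in\gamma_1$. -/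

import Mathlib

open Set Filter Topology MeasureTheory

noncomputable section

namespace AsympAP

/-- Euclidean space `ℝⁿ`. -/
abbrev E (n : ℕ) : Type := EuclideanSpace ℝ (Fin n)

/-- `τ` is an `ε`-translation number of `g`. -/
def IsTranslationNumber {n : ℕ} (g : ℝ → E n) (ε τ : ℝ) : Prop :=
  ∀ t : ℝ, ‖g (t + τ) - g t‖ < ε

/-- A set of reals is relatively dense if some length `l > 0` is such that every closed interval of
length `l` meets it. -/
def RelativelyDense (S : Set ℝ) : Prop :=
  ∃ l : ℝ, 0 < l ∧ ∀ a : ℝ, ∃ τ ∈ Icc a (a + l), τ ∈ S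

/-- Almost periodic functions (in the sense of Bohr). -/
def IsAlmostPeriodic {n : ℕ} (g : C(ℝ, E n)) : Prop :=
  ∀ ε : ℝ, 0 < ε → RelativelyDense {τ | IsTranslationNumber g ε τ}

/-- Asymptotically almost periodic functions on `ℝ`: almost periodic plus a continuous function
that tends to `0` at `+∞`. -/
def IsAsympAlmostPeriodic {n : ℕ} (g : C(ℝ, E n)) : Prop :=
  ∃ p φ : C(ℝ, E n), IsAlmostPeriodic p ∧ Tendsto φ atTop (𝓝 0) ∧ ∀ t, g t = p t + φ t

/-- A continuous function on a half-line `[t₀, ∞)` is asymptotically almost periodic if it is the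
restriction of an asymptotically almost periodic function on `ℝ`. -/
def IsAsympAlmostPeriodicOn {n : ℕ} {t₀ : ℝ} (y : C(Ici t₀, E n)) : Prop :=
  ∃ g : C(ℝ, E n), IsAsympAlmostPeriodic g ∧ ∀ t : Ici t₀, y t = g t

/-- `C` as a linear operator on `ℝⁿ`. -/
abbrev op {n : ℕ} (C : Matrix (Fin n) (Fin n) ℝ) : E n →L[ℝ] E n :=
  Matrix.toEuclideanCLM (𝕜 := ℝ) C

/-- `x` is a solution on `ℝ` of the linear system `x' = C x`. -/
def IsLinearSolution {n : ℕ} (C : Matrix (Fin n) (Fin n) ℝ) (x : C(ℝ, E n)) : Prop :=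
  ∀ t : ℝ, HasDerivAt x (op C (x t)) t

/-- `y` is a solution on `[t₀, ∞)` of `y' = C y + f(t, y)` (with the right derivative at `t₀`). -/
def IsQuasilinearSolution {n : ℕ} (C : Matrix (Fin n) (Fin n) ℝ) (f : ℝ → E n → E n) {t₀ : ℝ}
    (y : C(Ici t₀, E n)) : Prop :=
  ∀ t : Ici t₀, HasDerivWithinAt (IciExtend y) (op C (y t) + f t (y t)) (Ici t₀) t

/-- `C` as an operator on `ℂⁿ`. -/
def complexOp {n : ℕ} (C : Matrix (Fin n) (Fin n) ℝ) : Module.End ℂ (Fin n → ℂ) :=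
  Matrix.toLin' (C.map (fun a : ℝ => (a : ℂ)))

/-- The (complex) eigenvalues of `C`, a finite set which is nonempty for `n ≥ 1`. -/
def eigenvalues {n : ℕ} (C : Matrix (Fin n) (Fin n) ℝ) : Set ℂ :=
  {z | (complexOp C).HasEigenvalue z}

/-- The smallest real part of an eigenvalue of `C`. -/
def minRe {n : ℕ} (C : Matrix (Fin n) (Fin n) ℝ) : ℝ := sInf (Complex.re '' eigenvalues C)

/-- The largest real part of an eigenvalue of `C`. -/
def maxRe {n : ℕ} (C : Matrix (Fin n) (Fin n) ℝ) : ℝ := sSup (Complex.re '' eigenvalues C)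

/-- The maximum of the degrees of the elementary divisors `(X - z) ^ e` of `C` for eigenvalues `z`
of real part `r`. For one eigenvalue `z`, the largest such `e` is the size of the largest Jordan
block of `z`, that is, the least `e` at which the kernels of `(C - z) ^ e` become stationary. -/
def maxElemDivDegree {n : ℕ} (C : Matrix (Fin n) (Fin n) ℝ) (r : ℝ) : ℕ :=
  sSup ((fun z => (complexOp C).maxGenEigenspaceIndex z) '' {z ∈ eigenvalues C | z.re = r})

/-- `m_α`, where `α` is the smallest real part of an eigenvalue. -/
def mMin {n : ℕ} (C : Matrix (Fin n) (Fin n) ℝ) : ℕ := maxElemDivDegree C (minRe C)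

/-- `m_β`, where `β` is the largest real part of an eigenvalue. -/
def mMax {n : ℕ} (C : Matrix (Fin n) (Fin n) ℝ) : ℕ := maxElemDivDegree C (maxRe C)

/-- The Lipschitz condition on `f`, with `η` nonnegative on `[0, ∞)`. -/
def CondLipschitz {n : ℕ} (f : ℝ → E n → E n) (η : ℝ → ℝ) : Prop :=
  (∀ t, 0 ≤ t → 0 ≤ η t) ∧
    ∀ t, 0 ≤ t → ∀ x₁ x₂ : E n, ‖f t x₁ - f t x₂‖ ≤ η t * ‖x₁ - x₂‖

/-- `∫₀^∞ t^(m_β + m_α - 2) e^((β - α) t) η(t) dt < ∞`; here `m_α, m_β ≥ 1`. -/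
def CondIntegrable {n : ℕ} (C : Matrix (Fin n) (Fin n) ℝ) (η : ℝ → ℝ) : Prop :=
  IntegrableOn
    (fun t => t ^ (mMax C + mMin C - 2) * Real.exp ((maxRe C - minRe C) * t) * η t) (Ioi 0)

/-- `∫_t^∞ (s - t)^(m_α - 1) s^(m_β - 1) e^(α (t - s)) e^(β s) η(s) ds → 0` as `t → ∞`.
(Under `CondIntegrable` the integrand is integrable for every `t ≥ 0`.) -/
def CondTail {n : ℕ} (C : Matrix (Fin n) (Fin n) ℝ) (η : ℝ → ℝ) : Prop :=
  Tendsto (fun t : ℝ => ∫ s in Ioi t, (s - t) ^ (mMin C - 1) * s ^ (mMax C - 1) *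
    Real.exp (minRe C * (t - s)) * Real.exp (maxRe C * s) * η s) atTop (𝓝 0)

/-- `S` is a `k`-parameter family: its members depend continuously and injectively on `k` real
parameters that range over a nonempty open subset of `ℝᵏ`. For sets of continuous functions the
topology is that of locally uniform convergence (the compact-open topology). -/
def IsParameterFamily (k : ℕ) {X : Type*} [TopologicalSpace X] (S : Set X) : Prop :=
  ∃ U : Set (E k), IsOpen U ∧ U.Nonempty ∧
    ∃ p : U → X, Continuous p ∧ Function.Injective p ∧ range p = S

end AsympAP

end

noncomputable section

namespace AsympAP

open scoped BoundedContinuousFunction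

set_option linter.unusedSectionVars false

/-! Write A for the operator C. To an almost periodic solution x one attaches the bounded solution y
of y(t) = x(t) - ∫_t^∞ e^((t-s)A) f(s, y(s)) ds; it solves the perturbed equation, and the integral
tends to 0.

A nonzero almost periodic solution is bounded, which forces α ≤ 0 ≤ β
(`minRe_nonpos_and_maxRe_nonneg`). The Jordan structure gives ‖e^(-tA)‖ ≤ K (1+t)^(m_α-1) e^(-αt)
for t ≥ 0. Hence for t₀ ≤ t < s the kernel times η(s) is at most w(s) = K (1+s)^(m_α-1) e^(-αs)
η(s), and (C4) together with β ≥ 0 makes w integrable (`exists_isDominated`).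

The weight W(t) = exp(2 ∫_t^∞ w) satisfies ∫_t^∞ w W ≤ W(t)/2. In the W-weighted sup norm the
integral operator is therefore a 1/2-contraction on all of [t₀, ∞), however large w is, and y
depends on x in a Lipschitz way (`IsDominated.exists_perturbation`).

For the homeomorphism, the sup norm of a bounded solution of x' = Ax is controlled by its value at
any single time (`exists_norm_le_mul_norm`), so distances in γ₁ can be read off at one time. At a
time T where the tail of w is small, x(T) is in turn controlled by y(T), which yields injectivity
and a continuous inverse (`IsDominated.exists_homeomorph`). -/

/-- The tail integral `∫_t^∞ w`. -/
def tailIntegral (w : ℝ → ℝ) (t : ℝ) : ℝ := ∫ s in Ioi t, w s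

/-! ### Tail integrals and the exponential weight. -/

section Tail

variable {F : Type*} [NormedAddCommGroup F] [NormedSpace ℝ F]

theorem integral_Ioi_eq_sub_intervalIntegral {g : ℝ → F} {a : ℝ} (hg : ∀ b, IntegrableOn g (Ioi b))
    (t : ℝ) : ∫ s in Ioi t, g s = (∫ s in Ioi a, g s) - ∫ s in a..t, g s := by
  rw [eq_sub_iff_add_eq, add_comm]
  refine intervalIntegral.integral_interval_add_Ioi (hg a) (hg t)

theorem hasDerivAt_integral_Ioi [CompleteSpace F] {g : ℝ → F} (hg : ∀ b, IntegrableOn g (Ioi b))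
    (hc : Continuous g) (t : ℝ) :
    HasDerivAt (fun t => ∫ s in Ioi t, g s) (-g t) t := by
  have h := (hasDerivAt_const t (∫ s in Ioi (0 : ℝ), g s)).sub
    (hc.integral_hasStrictDerivAt 0 t).hasDerivAt
  rw [zero_sub] at h
  refine h.congr_of_eventuallyEq (Eventually.of_forall fun t => ?_)
  exact integral_Ioi_eq_sub_intervalIntegral hg t

end Tail

theorem tailIntegral_nonneg {w : ℝ → ℝ} (h0 : ∀ s, 0 ≤ w s) (t : ℝ) : 0 ≤ tailIntegral w t :=
  setIntegral_nonneg measurableSet_Ioi fun s _ => h0 s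

theorem tailIntegral_le {w : ℝ → ℝ} (hw : Integrable w) (h0 : ∀ s, 0 ≤ w s) (t : ℝ) :
    tailIntegral w t ≤ ∫ s, w s :=
  setIntegral_le_integral hw (Eventually.of_forall h0)

theorem antitone_tailIntegral {w : ℝ → ℝ} (hw : Integrable w) (h0 : ∀ s, 0 ≤ w s) :
    Antitone (tailIntegral w) := fun _ _ hab =>
  setIntegral_mono_set hw.integrableOn (Eventually.of_forall h0)
    (Ioi_subset_Ioi hab).eventuallyLE

theorem continuous_tailIntegral {w : ℝ → ℝ} (hw : Integrable w) : Continuous (tailIntegral w) := by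
  have : tailIntegral w = fun t => (∫ s in Ioi 0, w s) - ∫ s in (0 : ℝ)..t, w s :=
    funext fun t => integral_Ioi_eq_sub_intervalIntegral (fun _ => hw.integrableOn) t
  rw [this]
  exact continuous_const.sub
    (intervalIntegral.continuous_primitive (fun _ _ => hw.intervalIntegrable) 0)

theorem ae_hasDerivAt_tailIntegral {w : ℝ → ℝ} (hw : Integrable w) :
    ∀ᵐ t, HasDerivAt (tailIntegral w) (-w t) t := by
  filter_upwards [LocallyIntegrable.ae_hasDerivAt_integral hw.locallyIntegrable] with t ht
  have h := (hasDerivAt_const t (∫ s in Ioi (0 : ℝ), w s)).sub (ht 0)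
  rw [zero_sub] at h
  exact h.congr_of_eventuallyEq (Eventually.of_forall fun t =>
    integral_Ioi_eq_sub_intervalIntegral (fun _ => hw.integrableOn) t)

theorem tendsto_tailIntegral {w : ℝ → ℝ} : Tendsto (tailIntegral w) atTop (𝓝 0) :=
  tendsto_integral_Ioi_zero tendsto_id

/-- The weight `exp (2 ∫_t^∞ w)`. -/
def tailWeight (w : ℝ → ℝ) (t : ℝ) : ℝ := Real.exp (2 * tailIntegral w t)

theorem tailWeight_pos (w : ℝ → ℝ) (t : ℝ) : 0 < tailWeight w t := Real.exp_pos _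

theorem one_le_tailWeight {w : ℝ → ℝ} (h0 : ∀ s, 0 ≤ w s) (t : ℝ) : 1 ≤ tailWeight w t :=
  Real.one_le_exp (mul_nonneg zero_le_two (tailIntegral_nonneg h0 t))

theorem tailWeight_le {w : ℝ → ℝ} (hw : Integrable w) (h0 : ∀ s, 0 ≤ w s) (t : ℝ) :
    tailWeight w t ≤ Real.exp (2 * ∫ s, w s) :=
  Real.exp_le_exp.2 (mul_le_mul_of_nonneg_left (tailIntegral_le hw h0 t) zero_le_two)

theorem continuous_tailWeight {w : ℝ → ℝ} (hw : Integrable w) : Continuous (tailWeight w) :=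
  Real.continuous_exp.comp (continuous_const.mul (continuous_tailIntegral hw))

theorem integrable_mul_tailWeight {w : ℝ → ℝ} (hw : Integrable w) (h0 : ∀ s, 0 ≤ w s) :
    Integrable fun s => w s * tailWeight w s := by
  refine hw.mul_bdd (c := Real.exp (2 * ∫ s, w s))
    (continuous_tailWeight hw).aestronglyMeasurable (Eventually.of_forall fun s => ?_)
  rw [Real.norm_of_nonneg (tailWeight_pos w s).le]
  exact tailWeight_le hw h0 s

/-- Almost everywhere W' = -2wW, so w W is the derivative of -W/2. This is where the contraction
constant 1/2 comes from. -/
theorem integral_mul_tailWeight_le {w : ℝ → ℝ} (hw : Integrable w) (h0 : ∀ s, 0 ≤ w s) (t : ℝ) :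
    ∫ s in Ioi t, w s * tailWeight w s ≤ tailWeight w t / 2 := by
  refine le_of_tendsto (intervalIntegral_tendsto_integral_Ioi t
    (integrable_mul_tailWeight hw h0).integrableOn tendsto_id) ?_
  filter_upwards [eventually_ge_atTop t] with T hT
  have hmono : Monotone fun s => -(tailWeight w s / 2) := fun a b hab =>
    neg_le_neg (div_le_div_of_nonneg_right (Real.exp_le_exp.2 (mul_le_mul_of_nonneg_left
      (antitone_tailIntegral hw h0 hab) zero_le_two)) zero_le_two)
  have hderiv : ∀ᵐ s, deriv (fun s => -(tailWeight w s / 2)) s = w s * tailWeight w s := by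
    filter_upwards [ae_hasDerivAt_tailIntegral hw] with s hs
    have h := (((hs.const_mul 2).exp).div_const 2).neg
    refine h.deriv.trans ?_
    rw [tailWeight]; ring
  -- For a monotone function the integral of the a.e. derivative is at most the increment; this
  -- inequality suffices, so absolute continuity is not needed.
  have h := (hmono.monotoneOn (uIcc t T)).intervalIntegral_deriv_mem_uIcc
  rw [uIcc_of_le (sub_nonneg.2 (hmono hT))] at h
  rw [id, ← intervalIntegral.integral_congr_ae (hderiv.mono fun s hs _ => hs)]
  refine h.2.trans ?_
  have := tailWeight_pos w T
  linarith

/-! ### The linear flow and the weighted fixed-point problem. -/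

section Flow

variable {F : Type*} [NormedAddCommGroup F] [NormedSpace ℝ F] [CompleteSpace F]

/-- The flow `exp (t A)` of the linear system `x' = A x`. -/
def flow (A : F →L[ℝ] F) (t : ℝ) : F →L[ℝ] F := NormedSpace.exp (t • A)

@[simp]
theorem flow_zero (A : F →L[ℝ] F) : flow A 0 = 1 := by simp [flow]

theorem flow_add (A : F →L[ℝ] F) (s t : ℝ) : flow A (s + t) = flow A s * flow A t := by
  let _ : NormedAlgebra ℚ (F →L[ℝ] F) := NormedAlgebra.restrictScalars ℚ ℝ _
  rw [flow, flow, flow, add_smul]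
  exact NormedSpace.exp_add_of_commute (((Commute.refl A).smul_left s).smul_right t)

theorem flow_add_apply (A : F →L[ℝ] F) (s t : ℝ) (v : F) :
    flow A (s + t) v = flow A s (flow A t v) := by rw [flow_add]; rfl

theorem hasDerivAt_flow (A : F →L[ℝ] F) (t : ℝ) : HasDerivAt (flow A) (A * flow A t) t :=
  hasDerivAt_exp_smul_const' A t

theorem hasDerivAt_flow' (A : F →L[ℝ] F) (t : ℝ) : HasDerivAt (flow A) (flow A t * A) t :=
  hasDerivAt_exp_smul_const A t

theorem continuous_flow (A : F →L[ℝ] F) : Continuous (flow A) :=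
  continuous_iff_continuousAt.2 fun t => (hasDerivAt_flow A t).continuousAt

/-- Solutions of `x' = A x` are given by the flow. -/
theorem eq_flow_of_hasDerivAt {A : F →L[ℝ] F} {x : ℝ → F} (hx : ∀ t, HasDerivAt x (A (x t)) t)
    (t : ℝ) : x t = flow A t (x 0) := by
  have hd : ∀ t, HasDerivAt (fun t => flow A (-t) (x t)) 0 t := fun t => by
    have h := ((hasDerivAt_flow' A (-t)).scomp t (hasDerivAt_neg t)).clm_apply (hx t)
    convert! h using 1
    simp
  have hc := is_const_of_deriv_eq_zero (fun t => (hd t).differentiableAt) (fun t => (hd t).deriv) t 0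
  simp only [neg_zero, flow_zero, one_apply_eq_self] at hc
  rw [← hc, ← flow_add_apply, add_neg_cancel, flow_zero, one_apply_eq_self]

/-- The nonlinearity `f` is continuous, vanishes at `0`, and, transported back along the flow of
`A`, has the integrable function `w` as a Lipschitz constant on `[t₀, ∞)`. -/
structure IsDominated (A : F →L[ℝ] F) (f : ℝ → F → F) (w : ℝ → ℝ) (t₀ : ℝ) : Prop where
  cont : Continuous fun q : ℝ × F => f q.1 q.2
  map_zero : ∀ t, f t 0 = 0
  integrable : Integrable w
  nonneg : ∀ s, 0 ≤ w s
  bound : ∀ t s, t₀ ≤ t → t < s → ∀ x₁ x₂,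
    ‖flow A (t - s) (f s x₁ - f s x₂)‖ ≤ w s * ‖x₁ - x₂‖

/-- The integral `∫_t^∞ e^((t - s) A) f(s, z(s)) ds`. -/
def backward (A : F →L[ℝ] F) (f : ℝ → F → F) (z : ℝ → F) (t : ℝ) : F :=
  ∫ s in Ioi t, flow A (t - s) (f s (z s))

namespace IsDominated

variable {A : F →L[ℝ] F} {f : ℝ → F → F} {w : ℝ → ℝ} {t₀ : ℝ}

theorem continuous_integrand (h : IsDominated A f w t₀) {z : ℝ → F} (hz : Continuous z) (t : ℝ) :
    Continuous fun s => flow A (t - s) (f s (z s)) :=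
  ((continuous_flow A).comp (continuous_const.sub continuous_id)).clm_apply
    (h.cont.comp (continuous_id.prodMk hz))

theorem norm_integrand_le (h : IsDominated A f w t₀) {t s : ℝ} (ht : t₀ ≤ t) (hs : t < s) (x : F) :
    ‖flow A (t - s) (f s x)‖ ≤ w s * ‖x‖ := by
  simpa [h.map_zero] using h.bound t s ht hs x 0

theorem integrableOn_mul (h : IsDominated A f w t₀) {z : ℝ → F} (hz : Continuous z) {B : ℝ}
    (hB : ∀ s, ‖z s‖ ≤ B) (t : ℝ) : IntegrableOn (fun s => w s * ‖z s‖) (Ioi t) :=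
  (h.integrable.mul_bdd (c := B) hz.norm.aestronglyMeasurable
    (Eventually.of_forall fun s => by simpa using hB s)).integrableOn

theorem integrableOn_integrand_of_le (h : IsDominated A f w t₀) {z : ℝ → F} (hz : Continuous z)
    {B : ℝ} (hB : ∀ s, ‖z s‖ ≤ B) {t : ℝ} (ht : t₀ ≤ t) :
    IntegrableOn (fun s => flow A (t - s) (f s (z s))) (Ioi t) := by
  refine Integrable.mono' (h.integrableOn_mul hz hB t)
    (h.continuous_integrand hz t).aestronglyMeasurable ?_
  filter_upwards [ae_restrict_mem measurableSet_Ioi] with s hs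
  exact h.norm_integrand_le ht hs _

/-- Factoring e^(tA) out of the kernel leaves an integrand independent of t. Allowing b < t₀, where
only continuity on a compact interval is used, makes `backward` differentiable on all of ℝ, in
particular from both sides at t₀. -/
theorem integrableOn_flow_neg (h : IsDominated A f w t₀) {z : ℝ → F} (hz : Continuous z) {B : ℝ}
    (hB : ∀ s, ‖z s‖ ≤ B) (b : ℝ) :
    IntegrableOn (fun s => flow A (-s) (f s (z s))) (Ioi b) := by
  have h₁ : IntegrableOn (fun s => flow A (-s) (f s (z s))) (Ioi t₀) := by
    refine ((flow A (-t₀)).integrable_comp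
      (h.integrableOn_integrand_of_le hz hB le_rfl)).congr (Eventually.of_forall fun s => ?_)
    change flow A (-t₀) (flow A (t₀ - s) (f s (z s))) = _
    rw [← flow_add_apply, neg_add_eq_sub, sub_sub_cancel_left]
  have hc : Continuous fun s => flow A (-s) (f s (z s)) := by
    simpa using h.continuous_integrand hz 0
  have h₂ : IntegrableOn (fun s => flow A (-s) (f s (z s))) (Icc b t₀) :=
    hc.continuousOn.integrableOn_Icc
  refine (h₂.union h₁).mono_set fun s hs => ?_
  exact (le_or_gt s t₀).imp (fun h => ⟨le_of_lt hs, h⟩) id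

theorem backward_eq (h : IsDominated A f w t₀) {z : ℝ → F} (hz : Continuous z) {B : ℝ}
    (hB : ∀ s, ‖z s‖ ≤ B) (t : ℝ) :
    backward A f z t = flow A t (∫ s in Ioi t, flow A (-s) (f s (z s))) := by
  rw [← (flow A t).integral_comp_comm (h.integrableOn_flow_neg hz hB t), backward]
  simp_rw [← flow_add_apply, sub_eq_add_neg]

theorem hasDerivAt_backward (h : IsDominated A f w t₀) {z : ℝ → F} (hz : Continuous z) {B : ℝ}
    (hB : ∀ s, ‖z s‖ ≤ B) (t : ℝ) :
    HasDerivAt (backward A f z) (A (backward A f z t) - f t (z t)) t := by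
  have hc : Continuous fun s => flow A (-s) (f s (z s)) := by
    simpa using h.continuous_integrand hz 0
  have hd := (hasDerivAt_flow A t).clm_apply
    (hasDerivAt_integral_Ioi (h.integrableOn_flow_neg hz hB) hc t)
  rw [show backward A f z = _ from funext (h.backward_eq hz hB)]
  convert! hd using 1
  rw [_root_.map_neg, ← flow_add_apply, add_neg_cancel, flow_zero, sub_eq_add_neg]
  rfl

theorem norm_backward_sub_le (h : IsDominated A f w t₀) {z₁ z₂ : ℝ → F} (hz₁ : Continuous z₁)
    (hz₂ : Continuous z₂) {B₁ B₂ : ℝ} (hB₁ : ∀ s, ‖z₁ s‖ ≤ B₁) (hB₂ : ∀ s, ‖z₂ s‖ ≤ B₂) {t : ℝ}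
    (ht : t₀ ≤ t) :
    ‖backward A f z₁ t - backward A f z₂ t‖ ≤ ∫ s in Ioi t, w s * ‖z₁ s - z₂ s‖ := by
  rw [backward, backward, ← integral_sub (h.integrableOn_integrand_of_le hz₁ hB₁ ht)
    (h.integrableOn_integrand_of_le hz₂ hB₂ ht)]
  refine norm_integral_le_of_norm_le (h.integrableOn_mul (hz₁.sub hz₂) (B := B₁ + B₂)
    (fun s => (norm_sub_le _ _).trans (add_le_add (hB₁ s) (hB₂ s))) t) ?_
  filter_upwards [ae_restrict_mem measurableSet_Ioi] with s hs
  rw [← map_sub]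
  exact h.bound t s ht hs _ _

theorem backward_zero (h : IsDominated A f w t₀) (t : ℝ) : backward A f 0 t = 0 := by
  simp [backward, h.map_zero]

end IsDominated

theorem continuous_IciExtend {X : Type*} [TopologicalSpace X] {t₀ : ℝ} {y : Ici t₀ → X}
    (hy : Continuous y) : Continuous (IciExtend y) :=
  hy.comp (Continuous.subtype_mk (continuous_const.max continuous_id) _)

/-- The function `u` on `[t₀, ∞)`, multiplied by the weight and extended to `ℝ`. -/
def weighted (w : ℝ → ℝ) {t₀ : ℝ} (u : Ici t₀ →ᵇ F) : ℝ → F :=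
  IciExtend fun t : Ici t₀ => tailWeight w t • u t

namespace IsDominated

variable {A : F →L[ℝ] F} {f : ℝ → F → F} {w : ℝ → ℝ} {t₀ : ℝ}

theorem continuous_weighted (h : IsDominated A f w t₀) (u : Ici t₀ →ᵇ F) :
    Continuous (weighted w u) :=
  continuous_IciExtend
    (((continuous_tailWeight h.integrable).comp continuous_subtype_val).smul u.continuous)

theorem norm_tailWeight_smul_le (h : IsDominated A f w t₀) (u : Ici t₀ →ᵇ F) (t : Ici t₀) :
    ‖tailWeight w t • u t‖ ≤ Real.exp (2 * ∫ s, w s) * ‖u‖ := by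
  rw [norm_smul, Real.norm_of_nonneg (tailWeight_pos w _).le]
  exact mul_le_mul (tailWeight_le h.integrable h.nonneg _) (u.norm_coe_le_norm _)
    (norm_nonneg _) (Real.exp_pos _).le

theorem norm_weighted_le (h : IsDominated A f w t₀) (u : Ici t₀ →ᵇ F) (s : ℝ) :
    ‖weighted w u s‖ ≤ Real.exp (2 * ∫ s, w s) * ‖u‖ :=
  h.norm_tailWeight_smul_le u _

theorem norm_backward_weighted_sub_le (h : IsDominated A f w t₀) (u₁ u₂ : Ici t₀ →ᵇ F)
    (t : Ici t₀) :
    ‖backward A f (weighted w u₁) t - backward A f (weighted w u₂) t‖ ≤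
      tailWeight w t / 2 * dist u₁ u₂ := by
  refine (h.norm_backward_sub_le (h.continuous_weighted u₁) (h.continuous_weighted u₂)
    (h.norm_weighted_le u₁) (h.norm_weighted_le u₂) t.2).trans ?_
  refine le_trans ?_ (mul_le_mul_of_nonneg_right
    (integral_mul_tailWeight_le h.integrable h.nonneg t) dist_nonneg)
  rw [← integral_mul_const]
  refine setIntegral_mono_on (h.integrableOn_mul ((h.continuous_weighted u₁).sub
    (h.continuous_weighted u₂)) (fun s => (norm_sub_le _ _).trans (add_le_add
      (h.norm_weighted_le u₁ s) (h.norm_weighted_le u₂ s))) t)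
    ((integrable_mul_tailWeight h.integrable h.nonneg).mul_const _).integrableOn
    measurableSet_Ioi fun s hs => ?_
  rw [mul_assoc]
  refine mul_le_mul_of_nonneg_left ?_ (h.nonneg s)
  have hst : t₀ ≤ s := t.2.trans (le_of_lt hs)
  rw [weighted, weighted, IciExtend_of_mem _ hst, IciExtend_of_mem _ hst, ← smul_sub, norm_smul,
    Real.norm_of_nonneg (tailWeight_pos w _).le, ← dist_eq_norm]
  exact mul_le_mul_of_nonneg_left (BoundedContinuousFunction.dist_coe_le_dist _)
    (tailWeight_pos w _).le

theorem norm_backward_weighted_le (h : IsDominated A f w t₀) (u : Ici t₀ →ᵇ F) (t : Ici t₀) :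
    ‖backward A f (weighted w u) t‖ ≤ tailWeight w t / 2 * ‖u‖ := by
  have h0 : weighted w (0 : Ici t₀ →ᵇ F) = 0 := by
    ext s; simp [weighted, IciExtend]
  simpa [h0, h.backward_zero] using h.norm_backward_weighted_sub_le u 0 t

/-- The weighted integral operator whose fixed points are the solutions asymptotic to `x`. -/
def picard (h : IsDominated A f w t₀) (x u : Ici t₀ →ᵇ F) : Ici t₀ →ᵇ F :=
  BoundedContinuousFunction.ofNormedAddCommGroup
    (fun t : Ici t₀ => (tailWeight w t)⁻¹ • (x t - backward A f (weighted w u) t))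
    ((((continuous_tailWeight h.integrable).inv₀
      fun t => (tailWeight_pos w t).ne').comp continuous_subtype_val).smul (x.continuous.sub
        ((continuous_iff_continuousAt.2 fun t => (h.hasDerivAt_backward (h.continuous_weighted u)
          (h.norm_weighted_le u) t).continuousAt).comp continuous_subtype_val)))
    (‖x‖ + ‖u‖ / 2) (fun t => by
      have hp := tailWeight_pos w t
      rw [norm_smul, norm_inv, Real.norm_of_nonneg hp.le, inv_mul_le_iff₀ hp]
      have h₁ := norm_sub_le (x t) (backward A f (weighted w u) t)
      have h₂ := h.norm_backward_weighted_le u t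
      have h₃ := x.norm_coe_le_norm t
      have h₄ := mul_le_mul_of_nonneg_right (one_le_tailWeight h.nonneg t) (norm_nonneg x)
      linarith)

theorem picard_apply (h : IsDominated A f w t₀) (x u : Ici t₀ →ᵇ F) (t : Ici t₀) :
    h.picard x u t = (tailWeight w t)⁻¹ • (x t - backward A f (weighted w u) t) := rfl

theorem contractingWith_picard (h : IsDominated A f w t₀) (x : Ici t₀ →ᵇ F) :
    ContractingWith (1 / 2) (h.picard x) := by
  refine ⟨by norm_num, LipschitzWith.of_dist_le_mul fun u₁ u₂ => ?_⟩
  refine (BoundedContinuousFunction.dist_le (by positivity)).2 fun t => ?_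
  have hp := tailWeight_pos w t
  rw [picard_apply, picard_apply, dist_eq_norm, ← smul_sub, norm_smul, norm_inv,
    Real.norm_of_nonneg hp.le, inv_mul_le_iff₀ hp, sub_sub_sub_cancel_left, norm_sub_rev]
  refine (h.norm_backward_weighted_sub_le u₁ u₂ t).trans_eq ?_
  push_cast; ring

/-- Dividing by the weight does not increase distances, because the weight is at least 1. -/
theorem dist_picard_le (h : IsDominated A f w t₀) (x₁ x₂ u : Ici t₀ →ᵇ F) :
    dist (h.picard x₁ u) (h.picard x₂ u) ≤ dist x₁ x₂ := by
  refine (BoundedContinuousFunction.dist_le dist_nonneg).2 fun t => ?_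
  have hp := tailWeight_pos w t
  rw [picard_apply, picard_apply, dist_eq_norm, ← smul_sub, norm_smul, norm_inv,
    Real.norm_of_nonneg hp.le, inv_mul_le_iff₀ hp, sub_sub_sub_cancel_right, ← dist_eq_norm]
  exact (BoundedContinuousFunction.dist_coe_le_dist t).trans
    (le_mul_of_one_le_left dist_nonneg (one_le_tailWeight h.nonneg t))

/-- Every bounded continuous function `x` on `[t₀, ∞)` has a perturbation `S x` with
`S x (t) = x(t) - ∫_t^∞ e^((t - s) A) f(s, S x (s)) ds`, in a Lipschitz way. -/
theorem exists_perturbation (h : IsDominated A f w t₀) :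
    ∃ (S : (Ici t₀ →ᵇ F) → (Ici t₀ →ᵇ F)) (L : ℝ), 0 ≤ L ∧
      (∀ x₁ x₂, dist (S x₁) (S x₂) ≤ L * dist x₁ x₂) ∧
      ∀ x t, S x t = x t - backward A f (IciExtend (S x)) t := by
  -- `U x` is the sought solution divided by the weight; `S x` restores the weight.
  let U : (Ici t₀ →ᵇ F) → (Ici t₀ →ᵇ F) := fun x =>
    (h.contractingWith_picard x).fixedPoint (h.picard x)
  have hU : ∀ x, h.picard x (U x) = U x := fun x =>
    (h.contractingWith_picard x).fixedPoint_isFixedPt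
  -- The factor 2 is 1 / (1 - 1/2), from the contraction constant.
  have hUd : ∀ x₁ x₂, dist (U x₁) (U x₂) ≤ 2 * dist x₁ x₂ := fun x₁ x₂ => by
    have := (h.contractingWith_picard x₁).dist_fixedPoint_fixedPoint_of_dist_le' (h.picard x₂)
      (hU x₁) (hU x₂) (h.dist_picard_le x₁ x₂)
    refine this.trans_eq ?_
    push_cast; ring
  let S : (Ici t₀ →ᵇ F) → (Ici t₀ →ᵇ F) := fun x =>
    BoundedContinuousFunction.ofNormedAddCommGroup (fun t : Ici t₀ => tailWeight w t • U x t)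
      (((continuous_tailWeight h.integrable).comp continuous_subtype_val).smul (U x).continuous)
      _ (h.norm_tailWeight_smul_le (U x))
  have hS : ∀ x (t : Ici t₀), S x t = tailWeight w t • U x t := fun _ _ => rfl
  refine ⟨S, Real.exp (2 * ∫ s, w s) * 2, by positivity, fun x₁ x₂ => ?_, fun x t => ?_⟩
  · refine (BoundedContinuousFunction.dist_le (by positivity)).2 fun t => ?_
    rw [hS, hS, dist_smul₀, Real.norm_of_nonneg (tailWeight_pos w _).le, mul_assoc]
    exact mul_le_mul (tailWeight_le h.integrable h.nonneg _)
      ((BoundedContinuousFunction.dist_coe_le_dist t).trans (hUd x₁ x₂)) dist_nonneg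
      (Real.exp_pos _).le
  · rw [hS, ← hU x, picard_apply, smul_inv_smul₀ (tailWeight_pos w t).ne']
    rfl

/-- Without the weight the Lipschitz constant at time t is the tail of w, which tends to 0. This
gives both the asymptotics and, at a late time, the invertibility of the correspondence. -/
theorem norm_backward_IciExtend_sub_le (h : IsDominated A f w t₀) (y₁ y₂ : Ici t₀ →ᵇ F)
    (t : Ici t₀) :
    ‖backward A f (IciExtend y₁) t - backward A f (IciExtend y₂) t‖ ≤
      tailIntegral w t * dist y₁ y₂ := by
  refine (h.norm_backward_sub_le (continuous_IciExtend y₁.continuous)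
    (continuous_IciExtend y₂.continuous) (fun s => y₁.norm_coe_le_norm _)
    (fun s => y₂.norm_coe_le_norm _) t.2).trans ?_
  rw [tailIntegral, ← integral_mul_const]
  refine setIntegral_mono_on (h.integrableOn_mul ((continuous_IciExtend y₁.continuous).sub
    (continuous_IciExtend y₂.continuous)) (fun s => (norm_sub_le _ _).trans (add_le_add
      (y₁.norm_coe_le_norm _) (y₂.norm_coe_le_norm _))) t)
    (h.integrable.mul_const _).integrableOn measurableSet_Ioi fun s hs => ?_
  refine mul_le_mul_of_nonneg_left ?_ (h.nonneg s)
  rw [← dist_eq_norm]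
  exact BoundedContinuousFunction.dist_coe_le_dist (projIci t₀ s)

theorem tendsto_backward_IciExtend (h : IsDominated A f w t₀) (y : Ici t₀ →ᵇ F) :
    Tendsto (fun t : Ici t₀ => backward A f (IciExtend y) t) atTop (𝓝 0) := by
  have h0 : IciExtend (0 : Ici t₀ → F) = 0 := rfl
  have hlim : Tendsto (fun t : Ici t₀ => tailIntegral w t * ‖y‖) atTop (𝓝 0) := by
    simpa using (tendsto_comp_val_Ici_atTop.2 tendsto_tailIntegral).mul_const ‖y‖
  refine squeeze_zero_norm (fun t => ?_) hlim
  simpa [h0, h.backward_zero] using h.norm_backward_IciExtend_sub_le y 0 t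

end IsDominated

end Flow

/-- A power of `1 + t` times a slower exponential is dominated by a faster exponential. -/
theorem exists_pow_mul_exp_le {a b : ℝ} (hab : a < b) (j : ℕ) :
    ∃ K : ℝ, 0 ≤ K ∧ ∀ t : ℝ, 0 ≤ t → t ^ j * Real.exp (a * t) ≤ K * Real.exp (b * t) := by
  have hc : 0 < b - a := sub_pos.2 hab
  refine ⟨j.factorial / (b - a) ^ j, by positivity, fun t ht => ?_⟩
  -- The constant comes from (ct)^j / j! ≤ e^(ct) with c = b - a.
  have h := Real.pow_div_factorial_le_exp ((b - a) * t) (by positivity) j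
  rw [div_le_iff₀ (by positivity), mul_pow] at h
  have h2 : t ^ j ≤ j.factorial / (b - a) ^ j * Real.exp ((b - a) * t) := by
    rw [div_mul_eq_mul_div, le_div_iff₀ (by positivity)]
    linarith
  calc t ^ j * Real.exp (a * t)
      ≤ j.factorial / (b - a) ^ j * Real.exp ((b - a) * t) * Real.exp (a * t) :=
        mul_le_mul_of_nonneg_right h2 (Real.exp_pos _).le
    _ = _ := by rw [mul_assoc, ← Real.exp_add]; ring_nf

/-! ### Growth of solutions on generalized eigenspaces. -/

section Growth

variable {V : Type*} [NormedAddCommGroup V] [NormedSpace ℂ V] [FiniteDimensional ℂ V]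

/-- The vectors `v` for which `x' = A x`, `x(0) = v`, has a solution that is
`O((1 + t)^(m-1) e^(r t))` in the direction of time given by `σ`. -/
def growthSubmodule (A : Module.End ℂ V) (σ r : ℝ) (m : ℕ) : Submodule ℂ V where
  carrier := {v | ∃ x : ℝ → V, x 0 = v ∧ (∀ t, HasDerivAt x (A (x t)) t) ∧
    ∃ K : ℝ, ∀ t, 0 ≤ t → ‖x (σ * t)‖ ≤ K * ((1 + t) ^ (m - 1) * Real.exp (r * t))}
  zero_mem' := ⟨0, rfl, fun t => by simp [hasDerivAt_zero], 0, by simp⟩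
  add_mem' := by
    rintro _ _ ⟨x, rfl, hx, K, hK⟩ ⟨y, rfl, hy, L, hL⟩
    refine ⟨x + y, rfl, fun t => by simpa using (hx t).add (hy t), K + L, fun t ht => ?_⟩
    rw [add_mul]
    exact (norm_add_le _ _).trans (add_le_add (hK t ht) (hL t ht))
  smul_mem' := by
    rintro c _ ⟨x, rfl, hx, K, hK⟩
    refine ⟨c • x, rfl, fun t => by simpa using (hx t).const_smul c, ‖c‖ * K, fun t ht => ?_⟩
    rw [Pi.smul_apply, norm_smul, mul_assoc]
    exact mul_le_mul_of_nonneg_left (hK t ht) (norm_nonneg c)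

/-- The solution `e^(t z) ∑_{j < e} t^j / j! (A - z)^j v` starting at a vector `v` of the
generalized eigenspace of `z`. -/
def genEigenSolution (A : Module.End ℂ V) (z : ℂ) (e : ℕ) (v : V) (t : ℝ) : V :=
  Complex.exp (t * z) •
    ∑ j ∈ Finset.range e, ((t : ℂ) ^ j / j.factorial) • ((A - z • (1 : Module.End ℂ V)) ^ j) v

theorem genEigenSolution_zero {A : Module.End ℂ V} {z : ℂ} {e : ℕ} {v : V}
    (hv : ((A - z • (1 : Module.End ℂ V)) ^ e) v = 0) : genEigenSolution A z e v 0 = v := by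
  rcases e with _ | e
  · simpa [genEigenSolution] using hv.symm
  · simp [genEigenSolution, Finset.sum_range_succ']

theorem hasDerivAt_genEigenSolution {A : Module.End ℂ V} {z : ℂ} {e : ℕ} {v : V}
    (hv : ((A - z • (1 : Module.End ℂ V)) ^ e) v = 0) (t : ℝ) :
    HasDerivAt (genEigenSolution A z e v) (A (genEigenSolution A z e v t)) t := by
  set N : Module.End ℂ V := A - z • 1 with hN
  have hexp : HasDerivAt (fun t : ℝ => Complex.exp (t * z)) (Complex.exp (t * z) * z) t := by
    simpa using ((hasDerivAt_id t).ofReal_comp.mul_const z).cexp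
  have hterm : ∀ j : ℕ, HasDerivAt (fun t : ℝ => ((t : ℂ) ^ j / j.factorial) • (N ^ j) v)
      ((j * (t : ℂ) ^ (j - 1) / j.factorial) • (N ^ j) v) t := fun j => by
    have := (((hasDerivAt_id t).ofReal_comp.pow j).div_const (j.factorial : ℂ)).smul_const
      ((N ^ j) v)
    simpa using this
  have hsum := HasDerivAt.fun_sum fun j (_ : j ∈ Finset.range e) => hterm j
  have hd := hexp.smul hsum
  refine hd.congr_deriv ?_
  have hA : A = N + z • 1 := by rw [hN, sub_add_cancel]
  -- Differentiating the truncated exponential lowers each power of t by one; this equals applying N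
  -- because the new top term contains N^e v = 0.
  have hshift : ∑ j ∈ Finset.range e, ((j * (t : ℂ) ^ (j - 1) / j.factorial) • (N ^ j) v) =
      N (∑ j ∈ Finset.range e, ((t : ℂ) ^ j / j.factorial) • (N ^ j) v) := by
    rcases e with _ | e
    · simp
    · rw [Finset.sum_range_succ', Finset.sum_range_succ, map_add, map_smul, ← Module.End.mul_apply,
        ← pow_succ', hv, smul_zero, add_zero, map_sum]
      simp only [Nat.cast_zero, zero_mul, zero_div, zero_smul, add_zero]
      refine Finset.sum_congr rfl fun j _ => ?_
      rw [map_smul, ← Module.End.mul_apply, ← pow_succ', Nat.factorial_succ]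
      congr 1
      have h1 : ((j + 1 : ℕ) : ℂ) ≠ 0 := Nat.cast_ne_zero.2 j.succ_ne_zero
      have h2 : (j.factorial : ℂ) ≠ 0 := Nat.cast_ne_zero.2 j.factorial_ne_zero
      rw [Nat.cast_mul, Nat.add_sub_cancel]
      field_simp
  rw [hshift, genEigenSolution, map_smul, ← hN]
  conv_rhs => rw [hA]
  rw [LinearMap.add_apply, LinearMap.smul_apply, Module.End.one_apply, smul_add, smul_smul]

theorem norm_genEigenSolution_le (A : Module.End ℂ V) (z : ℂ) (e : ℕ) (v : V) {σ : ℝ}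
    (hσ : |σ| = 1) {t : ℝ} (ht : 0 ≤ t) :
    ‖genEigenSolution A z e v (σ * t)‖ ≤ Real.exp (σ * z.re * t) *
      ∑ j ∈ Finset.range e, t ^ j * ‖((A - z • (1 : Module.End ℂ V)) ^ j) v‖ := by
  rw [genEigenSolution, norm_smul, Complex.norm_exp]
  have hre : ((σ * t : ℝ) * z : ℂ).re = σ * z.re * t := by
    rw [Complex.re_ofReal_mul]; ring
  rw [hre]
  refine mul_le_mul_of_nonneg_left ?_ (Real.exp_pos _).le
  refine (norm_sum_le _ _).trans (Finset.sum_le_sum fun j _ => ?_)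
  rw [norm_smul]
  refine mul_le_mul_of_nonneg_right ?_ (norm_nonneg _)
  rw [norm_div, norm_pow, Complex.norm_real, Real.norm_eq_abs, abs_mul, hσ, one_mul,
    abs_of_nonneg ht, Complex.norm_natCast]
  exact div_le_self (by positivity) (by exact_mod_cast Nat.one_le_iff_ne_zero.2 j.factorial_ne_zero)

/-- If σ Re z < r, the faster exponential absorbs every power of t, so the index matters only on the
extremal line σ Re z = r. -/
theorem maxGenEigenspace_le_growthSubmodule {A : Module.End ℂ V} {z : ℂ} {σ r : ℝ} {m : ℕ}
    (hσ : |σ| = 1) (hz : σ * z.re ≤ r) (hm : σ * z.re = r → A.maxGenEigenspaceIndex z ≤ m) :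
    A.maxGenEigenspace z ≤ growthSubmodule A σ r m := by
  intro v hv
  rw [Module.End.maxGenEigenspace_eq, Module.End.mem_genEigenspace_nat, LinearMap.mem_ker] at hv
  set e := A.maxGenEigenspaceIndex z
  refine ⟨genEigenSolution A z e v, genEigenSolution_zero hv, hasDerivAt_genEigenSolution hv, ?_⟩
  set c : ℕ → ℝ := fun j => ‖((A - z • (1 : Module.End ℂ V)) ^ j) v‖ with hc
  have hterm : ∀ j ∈ Finset.range e, ∃ K : ℝ, ∀ t : ℝ, 0 ≤ t →
      t ^ j * Real.exp (σ * z.re * t) ≤ K * ((1 + t) ^ (m - 1) * Real.exp (r * t)) := by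
    intro j hj
    rcases hz.lt_or_eq with h | h
    · obtain ⟨K, hK0, hK⟩ := exists_pow_mul_exp_le h j
      refine ⟨K, fun t ht => (hK t ht).trans (mul_le_mul_of_nonneg_left ?_ hK0)⟩
      exact le_mul_of_one_le_left (Real.exp_pos _).le (one_le_pow₀ (by linarith))
    · refine ⟨1, fun t ht => ?_⟩
      rw [one_mul, h]
      refine mul_le_mul_of_nonneg_right ?_ (Real.exp_pos _).le
      have hjm : j ≤ m - 1 := by
        have := hm h
        have := Finset.mem_range.1 hj
        omega
      exact (pow_le_pow_left₀ ht (by linarith) j).trans (pow_le_pow_right₀ (by linarith) hjm)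
  choose! K hK using hterm
  refine ⟨∑ j ∈ Finset.range e, K j * c j, fun t ht => ?_⟩
  refine (norm_genEigenSolution_le A z e v hσ ht).trans ?_
  rw [Finset.mul_sum, Finset.sum_mul]
  refine Finset.sum_le_sum fun j hj => ?_
  have := mul_le_mul_of_nonneg_right (hK j hj t ht) (norm_nonneg _ : 0 ≤ c j)
  calc _ = t ^ j * Real.exp (σ * z.re * t) * c j := by rw [hc]; ring
    _ ≤ _ := this
    _ = _ := by ring

/-- The growth bound survives linear combinations, and the generalized eigenspaces span. -/
theorem growthSubmodule_eq_top {A : Module.End ℂ V} {σ r : ℝ} {m : ℕ} (hσ : |σ| = 1)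
    (hr : ∀ z, A.HasEigenvalue z → σ * z.re ≤ r)
    (hm : ∀ z, A.HasEigenvalue z → σ * z.re = r → A.maxGenEigenspaceIndex z ≤ m) :
    growthSubmodule A σ r m = ⊤ := by
  rw [eq_top_iff, ← Module.End.iSup_maxGenEigenspace_eq_top A]
  refine iSup_le fun z => ?_
  by_cases hz : A.HasEigenvalue z
  · exact maxGenEigenspace_le_growthSubmodule hσ (hr z hz) (hm z hz)
  · have hbot : A.maxGenEigenspace z = ⊥ := by
      by_contra hne
      rw [Module.End.maxGenEigenspace_eq] at hne
      exact hz (Module.End.hasEigenvalue_of_hasGenEigenvalue hne)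
    rw [hbot]
    exact bot_le

end Growth

/-! ### Operator bounds for the real flow. -/

section Real

variable {n : ℕ}

/-- The real part of a solution of the complexified system solves the real system. -/
theorem hasDerivAt_re {C : Matrix (Fin n) (Fin n) ℝ} {x : ℝ → Fin n → ℂ}
    (hx : ∀ t, HasDerivAt x (complexOp C (x t)) t) (t : ℝ) :
    HasDerivAt (fun t => WithLp.toLp 2 fun i => (x t i).re : ℝ → E n)
      (op C (WithLp.toLp 2 fun i => (x t i).re)) t := by
  rw [Matrix.toEuclideanCLM_toLp]
  have h : HasDerivAt (fun t => fun i => (x t i).re)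
      (C.mulVec fun i => (x t i).re) t := by
    refine hasDerivAt_pi.2 fun i => ?_
    have h1 := Complex.reCLM.hasFDerivAt.comp_hasDerivAt t (hasDerivAt_pi.1 (hx t) i)
    refine h1.congr_deriv ?_
    simp [complexOp, Matrix.mulVec, dotProduct]
  exact (PiLp.continuousLinearEquiv 2 ℝ fun _ : Fin n =>
    ℝ).symm.toContinuousLinearMap.hasFDerivAt.comp_hasDerivAt t h

theorem exists_norm_flow_le {C : Matrix (Fin n) (Fin n) ℝ} {σ r : ℝ} {m : ℕ} (hσ : |σ| = 1)
    (hr : ∀ z ∈ eigenvalues C, σ * z.re ≤ r)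
    (hm : ∀ z ∈ eigenvalues C, σ * z.re = r → (complexOp C).maxGenEigenspaceIndex z ≤ m) :
    ∃ K : ℝ, 0 ≤ K ∧ ∀ t : ℝ, 0 ≤ t →
      ‖flow (op C) (σ * t)‖ ≤ K * ((1 + t) ^ (m - 1) * Real.exp (r * t)) := by
  have hpt : ∀ v : E n, ∃ K : ℝ, ∀ t : ℝ, 0 ≤ t →
      ‖flow (op C) (σ * t) v‖ ≤ K * ((1 + t) ^ (m - 1) * Real.exp (r * t)) := by
    intro v
    have hv : (fun i => (v i : ℂ)) ∈ growthSubmodule (complexOp C) σ r m := by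
      rw [growthSubmodule_eq_top hσ hr hm]; trivial
    obtain ⟨x, hx0, hx, K, hK⟩ := hv
    set R : (Fin n → ℂ) →L[ℝ] E n :=
      (PiLp.continuousLinearEquiv 2 ℝ fun _ : Fin n => ℝ).symm.toContinuousLinearMap.comp
        (ContinuousLinearMap.pi fun i => Complex.reCLM.comp (ContinuousLinearMap.proj i)) with hR
    refine ⟨‖R‖ * K, fun t ht => ?_⟩
    have h := eq_flow_of_hasDerivAt (hasDerivAt_re hx) (σ * t)
    have h0 : (WithLp.toLp 2 fun i => (x 0 i).re : E n) = v := by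
      rw [hx0]; rfl
    rw [h0] at h
    rw [← h, mul_assoc]
    exact (R.le_opNorm (x (σ * t))).trans (mul_le_mul_of_nonneg_left (hK t ht) (norm_nonneg R))
  have hpos : ∀ t : Ici (0 : ℝ), 0 < (1 + (t : ℝ)) ^ (m - 1) * Real.exp (r * t) := fun t => by
    have : (0 : ℝ) ≤ t := t.2
    positivity
  -- Uniform boundedness of the normalized flow turns the constants depending on v into one
  -- constant.
  obtain ⟨K, hK⟩ := banach_steinhaus (g := fun t : Ici (0 : ℝ) =>
    ((1 + (t : ℝ)) ^ (m - 1) * Real.exp (r * t))⁻¹ • flow (op C) (σ * t)) fun v => by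
      obtain ⟨K, hK⟩ := hpt v
      refine ⟨K, fun t => ?_⟩
      rw [smul_apply, norm_smul, norm_inv, Real.norm_of_nonneg (hpos t).le,
        inv_mul_le_iff₀ (hpos t), mul_comm _ K]
      exact hK t t.2
  refine ⟨K, (norm_nonneg _).trans (hK ⟨0, le_refl (0 : ℝ)⟩), fun t ht => ?_⟩
  have h := hK ⟨t, ht⟩
  rw [norm_smul, norm_inv, Real.norm_of_nonneg (hpos ⟨t, ht⟩).le,
    inv_mul_le_iff₀ (hpos ⟨t, ht⟩), mul_comm _ K] at h
  exact h

end Real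

/-! ### Extremal real parts and elementary divisor degrees. -/

section Spectrum

variable {n : ℕ} (C : Matrix (Fin n) (Fin n) ℝ)

theorem finite_eigenvalues : (eigenvalues C).Finite :=
  (complexOp C).finite_hasEigenvalue

theorem nonempty_eigenvalues (hn : 0 < n) : (eigenvalues C).Nonempty := by
  have : Nonempty (Fin n) := ⟨⟨0, hn⟩⟩
  exact Module.End.exists_eigenvalue (complexOp C)

theorem minRe_le {z : ℂ} (hz : z ∈ eigenvalues C) : minRe C ≤ z.re :=
  csInf_le ((finite_eigenvalues C).image _).bddBelow (mem_image_of_mem _ hz)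

theorem le_maxRe {z : ℂ} (hz : z ∈ eigenvalues C) : z.re ≤ maxRe C :=
  le_csSup ((finite_eigenvalues C).image _).bddAbove (mem_image_of_mem _ hz)

theorem maxGenEigenspaceIndex_le {z : ℂ} (hz : z ∈ eigenvalues C) :
    (complexOp C).maxGenEigenspaceIndex z ≤ maxElemDivDegree C z.re :=
  le_csSup (((finite_eigenvalues C).subset (sep_subset _ _)).image _).bddAbove
    (mem_image_of_mem _ ⟨hz, rfl⟩)

/-- Index 0 would make the generalized eigenspace trivial. Positivity is what keeps the truncated
subtractions in the exponents honest. -/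
theorem one_le_maxElemDivDegree {z : ℂ} (hz : z ∈ eigenvalues C) :
    1 ≤ maxElemDivDegree C z.re := by
  refine le_trans ?_ (maxGenEigenspaceIndex_le C hz)
  by_contra h
  have h0 : (complexOp C).maxGenEigenspaceIndex z = 0 := by omega
  refine hz (le_bot_iff.1 ?_)
  have h1 := (complexOp C).maxGenEigenspace_eq z
  rw [h0] at h1
  calc _ ≤ (complexOp C).maxGenEigenspace z := Module.End.eigenspace_le_maxGenEigenspace
    _ ≤ ⊥ := by rw [h1]; simp

theorem one_le_mMin (hn : 0 < n) : 1 ≤ mMin C := by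
  obtain ⟨z, hz, hre⟩ := ((nonempty_eigenvalues C hn).image Complex.re).csInf_mem
    ((finite_eigenvalues C).image _)
  have := one_le_maxElemDivDegree C hz
  rwa [hre] at this

theorem one_le_mMax (hn : 0 < n) : 1 ≤ mMax C := by
  obtain ⟨z, hz, hre⟩ := ((nonempty_eigenvalues C hn).image Complex.re).csSup_mem
    ((finite_eigenvalues C).image _)
  have := one_le_maxElemDivDegree C hz
  rwa [hre] at this

theorem exists_norm_flow_le_maxRe : ∃ K : ℝ, 0 ≤ K ∧ ∀ t : ℝ, 0 ≤ t →
    ‖flow (op C) t‖ ≤ K * ((1 + t) ^ (mMax C - 1) * Real.exp (maxRe C * t)) := by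
  have h := exists_norm_flow_le (C := C) (σ := 1) (r := maxRe C) (m := mMax C) (by simp)
    (fun z hz => by simpa using le_maxRe C hz) (fun z hz h => by
      rw [mMax, ← h, one_mul]; exact maxGenEigenspaceIndex_le C hz)
  simpa only [one_mul] using h

theorem exists_norm_flow_neg_le_minRe : ∃ K : ℝ, 0 ≤ K ∧ ∀ t : ℝ, 0 ≤ t →
    ‖flow (op C) (-t)‖ ≤ K * ((1 + t) ^ (mMin C - 1) * Real.exp (-minRe C * t)) := by
  have h := exists_norm_flow_le (C := C) (σ := -1) (r := -minRe C) (m := mMin C) (by simp)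
    (fun z hz => by simpa using minRe_le C hz) (fun z hz h => by
      rw [mMin, ← neg_inj.1 ((neg_one_mul _).symm.trans h)]; exact maxGenEigenspaceIndex_le C hz)
  simpa only [neg_one_mul] using h

end Spectrum

/-! ### Almost periodicity: boundedness and asymptotic stability. -/

section AlmostPeriodic

variable {n : ℕ}

/-- A translation number moves any t into the compact interval [0, l] at a cost of at most 1. -/
theorem IsAlmostPeriodic.exists_norm_le {g : C(ℝ, E n)} (hg : IsAlmostPeriodic g) :
    ∃ B : ℝ, ∀ t, ‖g t‖ ≤ B := by
  obtain ⟨l, -, hl⟩ := hg 1 one_pos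
  obtain ⟨B, hB⟩ := isCompact_Icc.exists_bound_of_continuousOn (s := Icc 0 l) g.continuous.continuousOn
  refine ⟨B + 1, fun t => ?_⟩
  obtain ⟨τ, ⟨h1, h2⟩, hτ⟩ := hl (-t)
  have h3 := hB (t + τ) ⟨by linarith, by linarith⟩
  have h4 := hτ t
  have h5 := norm_sub_norm_le (g t) (g (t + τ))
  rw [norm_sub_rev] at h5
  linarith

theorem isAsympAlmostPeriodicOn_of_tendsto {t₀ : ℝ} {x : C(ℝ, E n)} (hx : IsAlmostPeriodic x)
    {y : C(Ici t₀, E n)} (h : Tendsto (fun t : Ici t₀ => x t - y t) atTop (𝓝 0)) :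
    IsAsympAlmostPeriodicOn y := by
  -- The difference is continued to the left of t₀ by its value at t₀.
  let φ : C(ℝ, E n) := ⟨IciExtend fun t : Ici t₀ => y t - x t,
    continuous_IciExtend (y.continuous.sub (x.continuous.comp continuous_subtype_val))⟩
  have hφ : ∀ t : Ici t₀, φ t = y t - x t := fun t =>
    IciExtend_coe (fun t : Ici t₀ => y t - x t) t
  refine ⟨x + φ, ⟨x, φ, hx, ?_, fun t => rfl⟩, fun t => ?_⟩
  · rw [← tendsto_comp_val_Ici_atTop (a := t₀)]
    simp_rw [hφ]
    simpa using h.neg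
  · rw [ContinuousMap.add_apply, hφ]
    abel

end AlmostPeriodic

/-! ### Exponential rates and integrability of the dominating function. -/

section Rates

theorem nonneg_of_le_pow_mul_exp {δ K r : ℝ} {j : ℕ} (hδ : 0 < δ)
    (h : ∀ t, 0 ≤ t → δ ≤ K * ((1 + t) ^ j * Real.exp (r * t))) : 0 ≤ r := by
  by_contra! hr
  have h1 : Tendsto (fun t : ℝ => (1 + t) ^ j * Real.exp (r * (1 + t))) atTop (𝓝 0) := by
    have := (tendsto_rpow_mul_exp_neg_mul_atTop_nhds_zero j (-r) (neg_pos.2 hr)).comp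
      (tendsto_atTop_add_const_left atTop 1 tendsto_id)
    simpa [Function.comp_def] using this
  have h2 : Tendsto (fun t : ℝ => K * ((1 + t) ^ j * Real.exp (r * t))) atTop (𝓝 0) := by
    have := (h1.mul_const (Real.exp (-r))).const_mul K
    simp only [zero_mul, mul_zero] at this
    refine this.congr fun t => ?_
    rw [mul_assoc ((1 + t) ^ j), ← Real.exp_add]
    ring_nf
  exact hδ.not_ge (ge_of_tendsto h2 ((eventually_ge_atTop 0).mono h))

/-- Beyond 1 one uses 1 + t ≤ 2t. Up to 1 the new weight is bounded and only η must be integrable: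
this is assumed when t₀ = 0, and otherwise holds because the given weight is at least t₀^q there. -/
theorem integrableOn_pow_mul_exp {η : ℝ → ℝ} (h0 : ∀ t, 0 ≤ t → 0 ≤ η t) {p q : ℕ} (hpq : p ≤ q)
    {a b : ℝ} (ha : 0 ≤ a) (hab : a ≤ b)
    (h : IntegrableOn (fun t => t ^ q * Real.exp (b * t) * η t) (Ioi 0)) {t₀ : ℝ} (ht₀ : 0 ≤ t₀)
    (hη : t₀ = 0 → IntegrableOn η (Icc 0 1)) :
    IntegrableOn (fun t => (1 + t) ^ p * Real.exp (a * t) * η t) (Ioi t₀) := by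
  -- Measurability of η is recovered by dividing out the positive weight.
  have hmeas : AEStronglyMeasurable η (volume.restrict (Ioi 0)) := by
    have hc : AEStronglyMeasurable (fun t : ℝ => (t ^ q * Real.exp (b * t))⁻¹)
        (volume.restrict (Ioi 0)) := by
      have : Measurable fun t : ℝ => (t ^ q * Real.exp (b * t))⁻¹ := by fun_prop
      exact this.aestronglyMeasurable
    refine (hc.mul h.aestronglyMeasurable).congr ?_
    filter_upwards [ae_restrict_mem measurableSet_Ioi] with t ht
    have ht : 0 < t := ht
    rw [Pi.mul_apply, inv_mul_cancel_left₀ (by positivity)]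
  have hmeas' : AEStronglyMeasurable (fun t => (1 + t) ^ p * Real.exp (a * t) * η t)
      (volume.restrict (Ioi 0)) := by
    refine AEStronglyMeasurable.mul (Continuous.aestronglyMeasurable ?_) hmeas
    fun_prop
  have hη1 : IntegrableOn η (Ioc t₀ 1) := by
    rcases ht₀.eq_or_lt with rfl | hpos
    · exact (hη rfl).mono_set Ioc_subset_Icc_self
    · have hsub : Ioc t₀ 1 ⊆ Ioi 0 := fun t ht => hpos.trans ht.1
      refine Integrable.mono' ((h.mono_set hsub).const_mul (t₀ ^ q)⁻¹)
        (hmeas.mono_set hsub) ?_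
      filter_upwards [ae_restrict_mem measurableSet_Ioc] with t ht
      have ht0 : 0 ≤ t := (hpos.trans ht.1).le
      rw [Real.norm_of_nonneg (h0 t ht0), ← div_eq_inv_mul, le_div_iff₀ (by positivity), mul_comm]
      refine mul_le_mul_of_nonneg_right ?_ (h0 t ht0)
      have h1 : t₀ ^ q ≤ t ^ q := pow_le_pow_left₀ ht₀ ht.1.le q
      have h2 : 1 ≤ Real.exp (b * t) := Real.one_le_exp (mul_nonneg (ha.trans hab) ht0)
      exact h1.trans (le_mul_of_one_le_right (by positivity) h2)
  have hA : IntegrableOn (fun t => (1 + t) ^ p * Real.exp (a * t) * η t) (Ioc t₀ 1) := by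
    have hsub : Ioc t₀ 1 ⊆ Ioi 0 := fun t ht => ht₀.trans_lt ht.1
    refine Integrable.mono' (hη1.const_mul (2 ^ p * Real.exp a)) (hmeas'.mono_set hsub) ?_
    filter_upwards [ae_restrict_mem measurableSet_Ioc] with t ht
    have ht0 : 0 ≤ t := ht₀.trans ht.1.le
    have hη0 := h0 t ht0
    rw [Real.norm_of_nonneg (by positivity)]
    refine mul_le_mul_of_nonneg_right (mul_le_mul (pow_le_pow_left₀ (by linarith)
      (by linarith [ht.2]) p) (Real.exp_le_exp.2 (mul_le_of_le_one_right ha ht.2))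
      (Real.exp_pos _).le (by positivity)) hη0
  have hB : IntegrableOn (fun t => (1 + t) ^ p * Real.exp (a * t) * η t) (Ioi 1) := by
    have hsub : Ioi (1 : ℝ) ⊆ Ioi 0 := Ioi_subset_Ioi zero_le_one
    refine Integrable.mono' ((h.mono_set hsub).const_mul (2 ^ p)) (hmeas'.mono_set hsub) ?_
    filter_upwards [ae_restrict_mem measurableSet_Ioi] with t ht
    have ht1 : 1 ≤ t := le_of_lt ht
    have ht0 : 0 ≤ t := zero_le_one.trans ht1
    have hη0 := h0 t ht0
    rw [Real.norm_of_nonneg (by positivity), ← mul_assoc]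
    refine mul_le_mul_of_nonneg_right ?_ hη0
    rw [← mul_assoc]
    refine mul_le_mul ?_ (Real.exp_le_exp.2 (mul_le_mul_of_nonneg_right hab ht0))
      (Real.exp_pos _).le (by positivity)
    calc (1 + t) ^ p ≤ (2 * t) ^ p := pow_le_pow_left₀ (by linarith) (by linarith) p
      _ = 2 ^ p * t ^ p := mul_pow _ _ _
      _ ≤ 2 ^ p * t ^ q := mul_le_mul_of_nonneg_left (pow_le_pow_right₀ ht1 hpq) (by positivity)
  exact (hA.union hB).mono_set fun t ht => (le_or_gt t 1).imp (fun h => ⟨ht, h⟩) id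

end Rates

/-! ### Bounded solutions of the linear system. -/

section Bounded

variable {F : Type*} [NormedAddCommGroup F] [NormedSpace ℝ F] [FiniteDimensional ℝ F]
  [CompleteSpace F]

/-- The initial values of the bounded solutions of `x' = A x`. -/
def boundedSubmodule (A : F →L[ℝ] F) : Submodule ℝ F where
  carrier := {v | ∃ B : ℝ, ∀ t, ‖flow A t v‖ ≤ B}
  zero_mem' := ⟨0, by simp⟩
  add_mem' := by
    rintro v v' ⟨B, hB⟩ ⟨B', hB'⟩
    refine ⟨B + B', fun t => ?_⟩
    rw [map_add]
    exact (norm_add_le _ _).trans (add_le_add (hB t) (hB' t))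
  smul_mem' := by
    rintro c v ⟨B, hB⟩
    refine ⟨‖c‖ * B, fun t => ?_⟩
    rw [map_smul, norm_smul]
    exact mul_le_mul_of_nonneg_left (hB t) (norm_nonneg c)

/-- Each orbit in this finite-dimensional, hence complete, subspace is bounded, so uniform
boundedness applies. -/
theorem exists_norm_flow_le_mul (A : F →L[ℝ] F) :
    ∃ N : ℝ, 0 ≤ N ∧ ∀ v ∈ boundedSubmodule A, ∀ t, ‖flow A t v‖ ≤ N * ‖v‖ := by
  obtain ⟨N, hN⟩ := banach_steinhaus
    (g := fun t : ℝ => (flow A t).comp (boundedSubmodule A).subtypeL) fun v => v.2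
  refine ⟨N, (norm_nonneg _).trans (hN 0), fun v hv t => ?_⟩
  exact (((flow A t).comp (boundedSubmodule A).subtypeL).le_opNorm ⟨v, hv⟩).trans
    (mul_le_mul_of_nonneg_right (hN t) (norm_nonneg _))

/-- The values of a bounded solution of `x' = A x` at any two times are comparable. -/
theorem exists_norm_le_mul_norm (A : F →L[ℝ] F) :
    ∃ N : ℝ, 0 ≤ N ∧ ∀ x : ℝ → F, (∀ t, HasDerivAt x (A (x t)) t) → (∃ B : ℝ, ∀ t, ‖x t‖ ≤ B) →
      ∀ s t, ‖x s‖ ≤ N * ‖x t‖ := by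
  obtain ⟨N, hN0, hN⟩ := exists_norm_flow_le_mul A
  refine ⟨N, hN0, fun x hx ⟨B, hB⟩ s t => ?_⟩
  have hshift : ∀ τ, x (τ + t) = flow A τ (x t) := fun τ => by
    have := eq_flow_of_hasDerivAt (A := A) (x := fun τ => x (τ + t))
      (fun τ => (hx (τ + t)).comp_add_const τ t) τ
    simpa using this
  have := hN (x t) ⟨B, fun τ => by rw [← hshift]; exact hB _⟩ (s - t)
  rwa [← hshift, sub_add_cancel] at this

end Bounded

theorem continuous_of_dist_le_mul {X Y Z : Type*} [TopologicalSpace X] [PseudoMetricSpace Y]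
    [PseudoMetricSpace Z] {F : X → Y} {e : X → Z} (he : Continuous e) {c : ℝ}
    (h : ∀ a b, dist (F a) (F b) ≤ c * dist (e a) (e b)) : Continuous F := by
  refine continuous_iff_continuousAt.2 fun a => tendsto_iff_dist_tendsto_zero.2 ?_
  refine squeeze_zero (fun _ => dist_nonneg) (fun b => h b a) ?_
  simpa using (tendsto_iff_dist_tendsto_zero.1 (he.tendsto a)).const_mul c

theorem continuous_toContinuousMap {X Y : Type*} [TopologicalSpace X] [PseudoMetricSpace Y] :
    Continuous (BoundedContinuousFunction.toContinuousMap : (X →ᵇ Y) → C(X, Y)) :=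
  ContinuousMap.continuous_of_continuous_uncurry _ continuous_eval

/-! ### The correspondence between solutions. -/

section Perturbation

variable {n : ℕ} {C : Matrix (Fin n) (Fin n) ℝ} {f : ℝ → E n → E n} {w : ℝ → ℝ} {t₀ : ℝ}

/-- A bounded solution of the integral equation solves the differential equation. -/
theorem IsDominated.isQuasilinearSolution (h : IsDominated (op C) f w t₀) {x : C(ℝ, E n)}
    (hx : IsLinearSolution C x) {y : Ici t₀ →ᵇ E n}
    (hy : ∀ t : Ici t₀, y t = x t - backward (op C) f (IciExtend y) t) :
    IsQuasilinearSolution C f y.toContinuousMap := by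
  intro t
  have hd := (hx t).sub (h.hasDerivAt_backward (continuous_IciExtend y.continuous)
    (fun s => y.norm_coe_le_norm _) t)
  have hyt : IciExtend y (t : ℝ) = y t := IciExtend_coe _ _
  have heq : ∀ s ∈ Ici t₀, IciExtend y s = x s - backward (op C) f (IciExtend y) s := fun s hs => by
    rw [IciExtend_of_mem _ hs, hy]
  refine (hd.hasDerivWithinAt (s := Ici t₀)).congr_of_mem heq t.2 |>.congr_deriv ?_
  change _ = op C (y t) + f t (y t)
  rw [hyt, hy t, map_sub]
  abel

/-- The bounded solutions in a set `γ₁` of solutions of `x' = C x` correspond homeomorphically to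
asymptotically equal solutions of the perturbed equation. -/
theorem IsDominated.exists_homeomorph (h : IsDominated (op C) f w t₀) {γ₁ : Set C(ℝ, E n)}
    (hlin : ∀ x ∈ γ₁, IsLinearSolution C x) (hbdd : ∀ x ∈ γ₁, ∃ B : ℝ, ∀ t, ‖x t‖ ≤ B) :
    ∃ (γ₂ : Set C(Ici t₀, E n)) (H : γ₁ ≃ₜ γ₂), ∀ x : γ₁,
      IsQuasilinearSolution C f (H x : C(Ici t₀, E n)) ∧
      Tendsto (fun t : Ici t₀ => (x : C(ℝ, E n)) t - (H x : C(Ici t₀, E n)) t) atTop (𝓝 0) := by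
  obtain ⟨N, hN0, hN⟩ := exists_norm_le_mul_norm (op C)
  obtain ⟨S, L, hL0, hL, hS⟩ := h.exists_perturbation
  have hcomp : ∀ (x₁ x₂ : γ₁) (s t : ℝ), dist (x₁.1 s) (x₂.1 s) ≤ N * dist (x₁.1 t) (x₂.1 t) := by
    intro x₁ x₂ s t
    rw [dist_eq_norm, dist_eq_norm]
    refine hN (fun t => x₁.1 t - x₂.1 t) (fun t => ?_) ?_ s t
    · rw [map_sub]
      exact (hlin x₁ x₁.2 t).sub (hlin x₂ x₂.2 t)
    · obtain ⟨B₁, hB₁⟩ := hbdd x₁ x₁.2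
      obtain ⟨B₂, hB₂⟩ := hbdd x₂ x₂.2
      exact ⟨B₁ + B₂, fun t => (norm_sub_le _ _).trans (add_le_add (hB₁ t) (hB₂ t))⟩
  choose! B hB using hbdd
  let b : γ₁ → (ℝ →ᵇ E n) := fun x =>
    BoundedContinuousFunction.ofNormedAddCommGroup x.1 x.1.continuous (B x.1) (hB x.1 x.2)
  have hb : ∀ x₁ x₂ t, dist (b x₁) (b x₂) ≤ N * dist (x₁.1 t) (x₂.1 t) := fun x₁ x₂ t =>
    (BoundedContinuousFunction.dist_le (by positivity)).2 fun s => hcomp x₁ x₂ s t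
  let r : γ₁ → (Ici t₀ →ᵇ E n) := fun x => (b x).compContinuous ⟨_, continuous_subtype_val⟩
  have hr : ∀ x₁ x₂ t, dist (r x₁) (r x₂) ≤ N * dist (x₁.1 t) (x₂.1 t) := fun x₁ x₂ t =>
    (BoundedContinuousFunction.dist_le (by positivity)).2 fun s => hcomp x₁ x₂ s t
  have hSr : ∀ x (t : Ici t₀), S (r x) t = x.1 t - backward (op C) f (IciExtend (S (r x))) t :=
    fun x t => hS (r x) t
  have hSd : ∀ x₁ x₂ t, dist (S (r x₁)) (S (r x₂)) ≤ L * N * dist (x₁.1 t) (x₂.1 t) :=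
    fun x₁ x₂ t => by
      rw [mul_assoc]
      exact (hL _ _).trans (mul_le_mul_of_nonneg_left (hr x₁ x₂ t) hL0)
  obtain ⟨T, hT⟩ : ∃ T : Ici t₀, tailIntegral w T * (L * N) < 1 / 2 := by
    have hlim : Tendsto (fun t : Ici t₀ => tailIntegral w t * (L * N)) atTop (𝓝 0) := by
      simpa using (tendsto_comp_val_Ici_atTop.2 tendsto_tailIntegral).mul_const (L * N)
    exact (hlim.eventually_lt_const (by norm_num)).exists
  -- The two integral terms differ at T by at most half of the distance of x₁(T) and x₂(T), which is
  -- absorbed on the left.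
  have hinv : ∀ x₁ x₂, dist (x₁.1 T) (x₂.1 T) ≤ 2 * dist (S (r x₁) T) (S (r x₂) T) := by
    intro x₁ x₂
    have h1 := h.norm_backward_IciExtend_sub_le (S (r x₁)) (S (r x₂)) T
    have h2 := mul_le_mul_of_nonneg_left (hSd x₁ x₂ T) (tailIntegral_nonneg h.nonneg T)
    have h3 : x₁.1 T - x₂.1 T = (S (r x₁) T - S (r x₂) T) +
        (backward (op C) f (IciExtend (S (r x₁))) T -
          backward (op C) f (IciExtend (S (r x₂))) T) := by
      rw [hSr, hSr]; abel
    have h4 := norm_add_le (S (r x₁) T - S (r x₂) T) (backward (op C) f (IciExtend (S (r x₁))) T -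
          backward (op C) f (IciExtend (S (r x₂))) T)
    rw [← h3, ← dist_eq_norm, ← dist_eq_norm] at h4
    have h5 := mul_le_mul_of_nonneg_right hT.le (dist_nonneg : 0 ≤ dist (x₁.1 T) (x₂.1 T))
    linarith
  let Ψ : γ₁ → C(Ici t₀, E n) := fun x => (S (r x)).toContinuousMap
  have hΨinj : Function.Injective Ψ := fun x₁ x₂ h12 => by
    have h1 := hinv x₁ x₂
    rw [show S (r x₁) T = S (r x₂) T from DFunLike.congr_fun h12 T, dist_self, mul_zero] at h1
    refine Subtype.ext (ContinuousMap.ext fun s => dist_le_zero.1 ((hcomp x₁ x₂ s T).trans ?_))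
    exact mul_nonpos_of_nonneg_of_nonpos hN0 h1
  have hΨc : Continuous Ψ := by
    have : Continuous fun x => S (r x) := continuous_of_dist_le_mul
      (e := fun x : γ₁ => x.1 0) ((continuous_eval_const (0 : ℝ)).comp continuous_subtype_val)
      fun x₁ x₂ => hSd x₁ x₂ 0
    exact continuous_toContinuousMap.comp this
  let e : γ₁ ≃ range Ψ := Equiv.ofInjective Ψ hΨinj
  have he : ∀ x, ((e x : range Ψ) : C(Ici t₀, E n)) = Ψ x := fun x => rfl
  have hec : Continuous e.symm := by
    -- The inverse is even Lipschitz from the value at T into the sup norm on ℝ.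
    have : Continuous fun y => b (e.symm y) := continuous_of_dist_le_mul (c := N * 2)
      (e := fun y : range Ψ => y.1 T) ((continuous_eval_const T).comp continuous_subtype_val)
      fun y₁ y₂ => by
        obtain ⟨x₁, rfl⟩ := e.surjective y₁
        obtain ⟨x₂, rfl⟩ := e.surjective y₂
        rw [e.symm_apply_apply, e.symm_apply_apply, mul_assoc]
        exact (hb x₁ x₂ T).trans (mul_le_mul_of_nonneg_left (hinv x₁ x₂) hN0)
    refine continuous_induced_rng.2 ?_
    exact continuous_toContinuousMap.comp this
  refine ⟨range Ψ, ⟨e, hΨc.subtype_mk _, hec⟩, fun x => ⟨?_, ?_⟩⟩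
  · exact h.isQuasilinearSolution (hlin x x.2) (hSr x)
  · refine (h.tendsto_backward_IciExtend (S (r x))).congr fun t => ?_
    change _ = x.1 t - S (r x) t
    rw [hSr, sub_sub_cancel]

/-- Since α ≤ 0, the backward bound grows with s - t and may be evaluated at s instead, which makes
it independent of t. Since β ≥ 0, the rate -α does not exceed β - α. -/
theorem exists_isDominated (hn : 0 < n) (hf : Continuous fun q : ℝ × E n => f q.1 q.2)
    (hf0 : ∀ t, f t 0 = 0) {η : ℝ → ℝ} (hlip : CondLipschitz f η) (hint : CondIntegrable C η)
    (ht₀ : 0 ≤ t₀) (hη₀ : t₀ = 0 → IntegrableOn η (Icc 0 1)) (hα : minRe C ≤ 0)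
    (hβ : 0 ≤ maxRe C) : ∃ w, IsDominated (op C) f w t₀ := by
  obtain ⟨K, hK0, hK⟩ := exists_norm_flow_neg_le_minRe C
  have hm := one_le_mMin C hn
  have hM := one_le_mMax C hn
  have hi : IntegrableOn
      (fun s => (1 + s) ^ (mMin C - 1) * Real.exp (-minRe C * s) * η s) (Ioi t₀) :=
    integrableOn_pow_mul_exp hlip.1 (by omega) (by linarith) (by linarith) hint ht₀ hη₀
  refine ⟨(Ioi t₀).indicator fun s =>
    K * ((1 + s) ^ (mMin C - 1) * Real.exp (-minRe C * s) * η s), hf, hf0,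
    (integrable_indicator_iff measurableSet_Ioi).2 (hi.const_mul K), fun s => ?_,
    fun t s hts hs x₁ x₂ => ?_⟩
  · refine indicator_nonneg (fun s hs => ?_) s
    have hs0 : 0 ≤ s := ht₀.trans (le_of_lt hs)
    have := hlip.1 s hs0
    positivity
  · have ht0 : 0 ≤ t := ht₀.trans hts
    have hs0 : 0 ≤ s := ht0.trans hs.le
    rw [indicator_of_mem (show s ∈ Ioi t₀ from hts.trans_lt hs), ← mul_assoc, mul_assoc _ (η s)]
    refine (ContinuousLinearMap.le_opNorm _ _).trans
      (mul_le_mul ?_ (hlip.2 s hs0 x₁ x₂) (norm_nonneg _) (by positivity))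
    rw [← neg_sub]
    refine (hK (s - t) (by linarith)).trans (mul_le_mul_of_nonneg_left (mul_le_mul
      (pow_le_pow_left₀ (by linarith) (by linarith) _) (Real.exp_le_exp.2
        (mul_le_mul_of_nonneg_left (by linarith) (by linarith))) (Real.exp_pos _).le
        (by positivity)) hK0)

/-- If `x' = C x` has a nonzero bounded solution, then the real parts of the eigenvalues of `C` are
not all of the same strict sign. -/
theorem minRe_nonpos_and_maxRe_nonneg {x : C(ℝ, E n)} (hx : IsLinearSolution C x) {B : ℝ}
    (hB : ∀ t, ‖x t‖ ≤ B) {s : ℝ} (hs : x s ≠ 0) : minRe C ≤ 0 ∧ 0 ≤ maxRe C := by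
  have hB0 : 0 ≤ B := (norm_nonneg _).trans (hB 0)
  have hflow := eq_flow_of_hasDerivAt hx
  have h0 : 0 < ‖x 0‖ := norm_pos_iff.2 fun h => hs (by rw [hflow, h, map_zero])
  have hback : ∀ t, x 0 = flow (op C) (-t) (x t) := fun t => by
    rw [hflow t, ← flow_add_apply, neg_add_cancel, flow_zero, one_apply_eq_self]
  -- Were α > 0 or β < 0, the flow norm on the right would tend to 0 as t → ∞ or t → -∞,
  -- contradicting x(0) ≠ 0.
  have hle : ∀ t, ‖x 0‖ ≤ ‖flow (op C) (-t)‖ * B := fun t => by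
    conv_lhs => rw [hback t]
    exact (ContinuousLinearMap.le_opNorm _ _).trans
      (mul_le_mul_of_nonneg_left (hB t) (norm_nonneg _))
  constructor
  · obtain ⟨K, -, hK⟩ := exists_norm_flow_neg_le_minRe C
    refine neg_nonneg.1 (nonneg_of_le_pow_mul_exp (K := B * K) (j := mMin C - 1) h0 fun t ht => ?_)
    rw [mul_assoc, mul_comm]
    exact (hle t).trans (mul_le_mul_of_nonneg_right (hK t ht) hB0)
  · obtain ⟨K, -, hK⟩ := exists_norm_flow_le_maxRe C
    refine nonneg_of_le_pow_mul_exp (K := B * K) (j := mMax C - 1) h0 fun t ht => ?_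
    rw [mul_assoc, mul_comm]
    have := hle (-t)
    rw [neg_neg] at this
    exact this.trans (mul_le_mul_of_nonneg_right (hK t ht) hB0)

theorem IsParameterFamily.of_homeomorph {k : ℕ} {X Y : Type*} [TopologicalSpace X]
    [TopologicalSpace Y] {S : Set X} {T : Set Y} (hS : IsParameterFamily k S) (H : S ≃ₜ T) :
    IsParameterFamily k T := by
  obtain ⟨U, hU, hne, p, hpc, hpi, rfl⟩ := hS
  refine ⟨U, hU, hne, fun u => H ⟨p u, mem_range_self u⟩, ?_, ?_, ?_⟩
  · exact continuous_subtype_val.comp (H.continuous.comp (hpc.subtype_mk _))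
  · intro u v huv
    exact hpi (Subtype.ext_iff.1 (H.injective (Subtype.ext huv)))
  · ext y
    constructor
    · rintro ⟨u, rfl⟩
      exact Subtype.coe_prop _
    · intro hy
      obtain ⟨⟨_, u, rfl⟩, hx⟩ := H.surjective ⟨y, hy⟩
      exact ⟨u, congrArg Subtype.val hx⟩

/-- The correspondence for the zero solution alone, for any `C`. -/
theorem exists_homeomorph_of_forall_eq_zero (hf0 : ∀ t, f t 0 = 0) {γ₁ : Set C(ℝ, E n)}
    (hne : γ₁.Nonempty) (hzero : ∀ x ∈ γ₁, x = 0) :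
    ∃ (γ₂ : Set C(Ici t₀, E n)) (H : γ₁ ≃ₜ γ₂), ∀ x : γ₁,
      IsQuasilinearSolution C f (H x : C(Ici t₀, E n)) ∧
      Tendsto (fun t : Ici t₀ => (x : C(ℝ, E n)) t - (H x : C(Ici t₀, E n)) t) atTop (𝓝 0) := by
  obtain rfl : γ₁ = {0} := eq_singleton_iff_nonempty_unique_mem.2 ⟨hne, hzero⟩
  refine ⟨{0}, Homeomorph.homeomorphOfUnique _ _, fun x => ?_⟩
  generalize (Homeomorph.homeomorphOfUnique ({0} : Set C(ℝ, E n)) ({0} : Set C(Ici t₀, E n))) x = y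
  obtain ⟨x, rfl⟩ := x
  obtain ⟨y, rfl⟩ := y
  refine ⟨fun t => ?_, by simp⟩
  have h0 : IciExtend (0 : C(Ici t₀, E n)) = 0 := rfl
  rw [h0]
  refine (hasDerivWithinAt_const (t : ℝ) (Ici t₀) (0 : E n)).congr_deriv ?_
  simp [hf0]

end Perturbation

end AsympAP

end

theorem corollary0 {n : ℕ} (hn : 0 < n)
    (C : Matrix (Fin n) (Fin n) ℝ)
    (f : ℝ → AsympAP.E n → AsympAP.E n)
    (hf : Continuous (fun q : ℝ × AsympAP.E n => f q.1 q.2))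
    (hf0 : ∀ t, f t 0 = 0)
    (η : ℝ → ℝ)
    (hC3 : AsympAP.CondLipschitz f η)
    (hC4 : AsympAP.CondIntegrable C η)
    (hC5 : AsympAP.CondTail C η)
    (t₀ : ℝ) (ht₀ : 0 ≤ t₀)
    (hη₀ : t₀ = 0 → IntegrableOn η (Icc 0 1))
    (k : ℕ) (hk : k ≤ n)
    (γ₁ : Set C(ℝ, AsympAP.E n))
    (hγ₁ : AsympAP.IsParameterFamily k γ₁)
    (hγ₁' : ∀ x ∈ γ₁, AsympAP.IsLinearSolution C x ∧ AsympAP.IsAlmostPeriodic x) :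
    ∃ γ₂ : Set C(Ici t₀, AsympAP.E n),
      AsympAP.IsParameterFamily k γ₂ ∧
      (∀ y ∈ γ₂, AsympAP.IsQuasilinearSolution C f y ∧ AsympAP.IsAsympAlmostPeriodicOn y) ∧
      ∃ h : γ₁ ≃ₜ γ₂, ∀ x : γ₁,
        Tendsto (fun t : Ici t₀ => (x : C(ℝ, AsympAP.E n)) t - (h x : C(Ici t₀, AsympAP.E n)) t)
          atTop (𝓝 0) := by
  have hmain : ∃ (γ₂ : Set C(Ici t₀, AsympAP.E n)) (H : γ₁ ≃ₜ γ₂), ∀ x : γ₁,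
      AsympAP.IsQuasilinearSolution C f (H x : C(Ici t₀, AsympAP.E n)) ∧
      Tendsto (fun t : Ici t₀ => (x : C(ℝ, AsympAP.E n)) t - (H x : C(Ici t₀, AsympAP.E n)) t)
        atTop (𝓝 0) := by
    -- The zero solution alone says nothing about the signs of α and β, so the domination argument
    -- needs a nonzero member of γ₁.
    by_cases hzero : ∀ x ∈ γ₁, x = 0
    · obtain ⟨U, -, ⟨u, hu⟩, p, -, -, rfl⟩ := hγ₁
      exact AsympAP.exists_homeomorph_of_forall_eq_zero hf0 ⟨_, mem_range_self ⟨u, hu⟩⟩ hzero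
    · push Not at hzero
      obtain ⟨x, hx, hx0⟩ := hzero
      obtain ⟨s, hs⟩ : ∃ s, x s ≠ 0 := by
        by_contra! h
        exact hx0 (ContinuousMap.ext h)
      obtain ⟨B, hB⟩ := (hγ₁' x hx).2.exists_norm_le
      obtain ⟨hα, hβ⟩ := AsympAP.minRe_nonpos_and_maxRe_nonneg (hγ₁' x hx).1 hB hs
      obtain ⟨w, hw⟩ := AsympAP.exists_isDominated hn hf hf0 hC3 hC4 ht₀ hη₀ hα hβ
      exact hw.exists_homeomorph (fun x hx => (hγ₁' x hx).1)
        fun x hx => (hγ₁' x hx).2.exists_norm_le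
  obtain ⟨γ₂, H, hH⟩ := hmain
  refine ⟨γ₂, hγ₁.of_homeomorph H, fun y hy => ?_, H, fun x => (hH x).2⟩
  obtain ⟨x, hx⟩ := H.surjective ⟨y, hy⟩
  have h := hH x
  rw [hx] at h
  exact ⟨h.1, AsympAP.isAsympAlmostPeriodicOn_of_tendsto (hγ₁' x x.2).2 h.2⟩
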